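/- Let $a_0,\dots,a_4\in\mathbb C$ be generic, i.e. put $a(x)=a_0+4a_1x+6a_2x^2+4a_3x^3+a_4x^4$ and assume that $a(x)$ has degree at least $3$ and no repeated root, so that the curve $C:\ y^2=a(x)$ has genus one. For $p\in\mathbb C$ put $$h(p)=\begin{pmatrix}a_0&2a_1&a_2-2p\\2a_1&4a_2+4p&2a_3\\a_2-2p&2a_3&a_4\end{pmatrix}.$$ Let $u\mapsto(x(u),y(u))$ and $v\mapsto(x_1(v),y_1(v))$ be meromorphic maps from convex open sets $D,E\subseteq\mathbb C$ to $C$ that invert the abelian integral $\int dx/y$, i.e. that satisfy $y^2=a(x)$, $x'=y$, $y'=\tfrac12a'(x)$ (so that $dx/y=2\,dy/a'(x)$ pulls back to $du$), and likewise for $(x_1,y_1)$. A function $\wp:\mathbb C\to\mathbb C$ is said to be defined by the covariant Klein relation if, for all $u\in D$, $v\in E$ at which these functions are holomorphic and $x(u)\ne x_1(v)$, $$y(u)\,y_1(v)=\mathbf x^t\,h\big(\wp(u+v)\big)\,\mathbf x_1,\qquad \mathbf x=(1,x(u),x(u)^2)^t,\quad \mathbf x_1=(1,x_1(v),x_1(v)^2)^t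 .$$ Then such a function $\wp$ exists. Moreover, every such $\wp$ is meromorphic on $D+E$, and at every point of $D+E$ at which it is holomorphic $$\wp'^2=-\tfrac14\det h(\wp),$$ that is, $$\wp'^2-4\wp^3=-(a_0a_4-4a_1a_3+3a_2^2)\,\wp-a_0a_2a_4+a_0a_3^2-2a_1a_2a_3+a_2^3+a_1^2a_4,$$ and $$\wp''=6\wp^2-\tfrac12(a_0a_4-4a_1a_3+3a_2^2).$$ -/

import Mathlib

open scoped Pointwise

noncomputable section

/-- The quartic `a₀ + 4 a₁ X + 6 a₂ X² + 4 a₃ X³ + a₄ X⁴`. -/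
def quartic (a : Fin 5 → ℂ) : Polynomial ℂ :=
  Polynomial.C (a 0) + Polynomial.C (4 * a 1) * Polynomial.X
    + Polynomial.C (6 * a 2) * Polynomial.X ^ 2
    + Polynomial.C (4 * a 3) * Polynomial.X ^ 3
    + Polynomial.C (a 4) * Polynomial.X ^ 4

/-- The coefficients are generic: the curve `y² = quartic a` has genus one. That is, the binary
quartic form has four distinct zeros on the projective line; one of them is the point at infinity
when the degree of the polynomial is three. -/
def IsGenusOne (a : Fin 5 → ℂ) : Prop :=
  3 ≤ (quartic a).natDegree ∧ (quartic a).Separable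

/-- The covariant Klein matrix `h`, with `p` in the place of the symbol `℘`. -/
def kleinMatrix (a : Fin 5 → ℂ) (p : ℂ) : Matrix (Fin 3) (Fin 3) ℂ :=
  !![a 0, 2 * a 1, a 2 - 2 * p;
     2 * a 1, 4 * a 2 + 4 * p, 2 * a 3;
     a 2 - 2 * p, 2 * a 3, a 4]

/-- The vector of monomials `(1, x, x²)`. -/
def monomialVec (x : ℂ) : Fin 3 → ℂ := ![1, x, x ^ 2]

/-- The covariant Klein relation `y y₁ = 𝐱ᵗ h 𝐱₁` between two points `(x, y)`, `(x₁, y₁)` and the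
value `p`. -/
def KleinRelation (a : Fin 5 → ℂ) (x y x₁ y₁ p : ℂ) : Prop :=
  y * y₁ = monomialVec x ⬝ᵥ (kleinMatrix a p).mulVec (monomialVec x₁)

/-- `u ↦ (x u, y u)` inverts the abelian integral `u = ∫ dx / y` of the curve `y² = quartic a`:
it is a meromorphic map from the convex open set `D` to the curve which pulls the holomorphic
differential `dx / y = 2 dy / (quartic a)'(x)` back to `du`. The second expression is the one that
is meaningful at the branch points `y = 0`, so both derivatives are prescribed. The conditions are
imposed at the points where both functions are analytic; the remaining points of `D` (those that
are mapped to infinity) form a discrete set. -/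
structure IsAbelianParam (a : Fin 5 → ℂ) (D : Set ℂ) (x y : ℂ → ℂ) : Prop where
  isOpen : IsOpen D
  convex : Convex ℝ D
  meromorphic_x : MeromorphicOn x D
  meromorphic_y : MeromorphicOn y D
  curve : ∀ u ∈ D, AnalyticAt ℂ x u → AnalyticAt ℂ y u → y u ^ 2 = (quartic a).eval (x u)
  deriv_x : ∀ u ∈ D, AnalyticAt ℂ x u → AnalyticAt ℂ y u → HasDerivAt x (y u) u
  deriv_y : ∀ u ∈ D, AnalyticAt ℂ x u → AnalyticAt ℂ y u →
    HasDerivAt y ((quartic a).derivative.eval (x u) / 2) u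

/-- `p` is the `℘`-function defined by the Klein relation: as a function of the sum
`u + v = ∫^x dx/y + ∫^{x₁} dx₁/y₁` of the two abelian integrals, it satisfies the Klein relation
for any two finite points of the curve with distinct abscissae. -/
def IsKleinWp (a : Fin 5 → ℂ) (D : Set ℂ) (x y : ℂ → ℂ) (E : Set ℂ) (x₁ y₁ : ℂ → ℂ)
    (p : ℂ → ℂ) : Prop :=
  ∀ u ∈ D, ∀ v ∈ E, AnalyticAt ℂ x u → AnalyticAt ℂ y u → AnalyticAt ℂ x₁ v →
    AnalyticAt ℂ y₁ v → x u ≠ x₁ v → KleinRelation a (x u) (y u) (x₁ v) (y₁ v) (p (u + v))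

end

open Filter Topology

/-! The Klein relation is affine in `p`: its right side is `H - 2p(x - z)²`, with `H` the polarized
quartic and `z` the second abscissa, so for `x ≠ z` it says `p = (H - yw)/(2(x - z)²)`
(`kleinRelation_iff`). Existence means that this value depends only on `u + v`, which is an addition
theorem: it is stationary when the two parameters move oppositely (`hasDerivAt_kleinWp_zero`), and
the identity theorem on a connected set makes it constant (`kleinWp_eq_of_add_eq`). For the
differential equations, freeze the first point. Then `℘` is differentiated along the invariant
vector field of the second one, and both equations become polynomial identities modulo the two curve
equations (`kleinWpDeriv_sq`, `kleinWpDeriv₂_eq`). They hold in punctured neighbourhoods, since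
separability keeps `x₁` from being locally constant, and extend by continuity. -/

/-- The symmetric bilinear form `𝐱ᵗ h(0) 𝐳`, a polarization of the quartic. -/
noncomputable def polarForm (a : Fin 5 → ℂ) (x z : ℂ) : ℂ :=
  a 0 + 2 * a 1 * (x + z) + a 2 * (x ^ 2 + 4 * x * z + z ^ 2) + 2 * a 3 * (x * z) * (x + z)
    + a 4 * (x * z) ^ 2

/-- The partial derivative of `polarForm a x z` with respect to `z`. -/
noncomputable def polarFormDeriv (a : Fin 5 → ℂ) (x z : ℂ) : ℂ :=
  2 * a 1 + a 2 * (4 * x + 2 * z) + 2 * a 3 * x * (x + 2 * z) + 2 * a 4 * x ^ 2 * z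

/-- The second partial derivative of `polarForm a x z` with respect to `z`. -/
noncomputable def polarFormDeriv₂ (a : Fin 5 → ℂ) (x : ℂ) : ℂ :=
  2 * a 2 + 4 * a 3 * x + 2 * a 4 * x ^ 2

theorem quartic_eval (a : Fin 5 → ℂ) (x : ℂ) : (quartic a).eval x =
    a 0 + 4 * a 1 * x + 6 * a 2 * x ^ 2 + 4 * a 3 * x ^ 3 + a 4 * x ^ 4 := by
  simp [quartic]

theorem quartic_derivative_eval (a : Fin 5 → ℂ) (x : ℂ) : (quartic a).derivative.eval x =
    4 * a 1 + 12 * a 2 * x + 12 * a 3 * x ^ 2 + 4 * a 4 * x ^ 3 := by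
  simp [quartic]
  ring

theorem quartic_derivative_derivative_eval (a : Fin 5 → ℂ) (x : ℂ) :
    (quartic a).derivative.derivative.eval x =
      12 * a 2 + 24 * a 3 * x + 12 * a 4 * x ^ 2 := by
  simp [quartic]
  ring

theorem hasDerivAt_polarForm (a : Fin 5 → ℂ) (x z : ℂ) :
    HasDerivAt (polarForm a x) (polarFormDeriv a x z) z := by
  have hz := hasDerivAt_id' z
  have h := ((((hz.const_add x).const_mul (2 * a 1)).const_add (a 0)).add
    (((hz.const_mul (4 * x)).const_add (x ^ 2)).add (hz.pow 2) |>.const_mul (a 2))).add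
    (((hz.const_mul x).const_mul (2 * a 3)).mul (hz.const_add x)) |>.add
    (((hz.const_mul x).pow 2).const_mul (a 4))
  refine (h.congr_deriv ?_).congr_of_eventuallyEq (.of_forall fun t ↦ ?_)
  · simp only [polarFormDeriv]; ring
  · simp [polarForm]

theorem hasDerivAt_polarFormDeriv (a : Fin 5 → ℂ) (x z : ℂ) :
    HasDerivAt (polarFormDeriv a x) (polarFormDeriv₂ a x) z := by
  have hz := hasDerivAt_id' z
  have h := ((((hz.const_mul 2).const_add (4 * x)).const_mul (a 2)).const_add (2 * a 1)).add
    (((hz.const_mul 2).const_add x).const_mul (2 * a 3 * x)) |>.add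
    (hz.const_mul (2 * a 4 * x ^ 2))
  refine (h.congr_deriv ?_).congr_of_eventuallyEq (.of_forall fun t ↦ ?_)
  · simp only [polarFormDeriv₂]; ring
  · simp [polarFormDeriv]

/-! ### Klein's formula for `℘` and its algebraic identities -/

/-- The solution `p` of the Klein relation. -/
noncomputable def kleinWp (a : Fin 5 → ℂ) (x y z w : ℂ) : ℂ :=
  (polarForm a x z - y * w) / (2 * (x - z) ^ 2)

/-- The numerator of the derivative of `kleinWp`. -/
noncomputable def kleinWpNum (a : Fin 5 → ℂ) (x y z w : ℂ) : ℂ :=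
  w * (polarFormDeriv a x z * (x - z) + 2 * polarForm a x z)
    - y * ((quartic a).derivative.eval z / 2 * (x - z) + 2 * (quartic a).eval z)

/-- The derivative of `kleinWp` along the invariant vector field in `(z, w)`. -/
noncomputable def kleinWpDeriv (a : Fin 5 → ℂ) (x y z w : ℂ) : ℂ :=
  kleinWpNum a x y z w / (2 * (x - z) ^ 3)

/-- The derivative of `kleinWpNum` along the invariant vector field in `(z, w)`. -/
noncomputable def kleinWpNumDeriv (a : Fin 5 → ℂ) (x y z w : ℂ) : ℂ :=
  (quartic a).derivative.eval z / 2 * (polarFormDeriv a x z * (x - z) + 2 * polarForm a x z)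
    + w * (polarFormDeriv₂ a x * (x - z) + polarFormDeriv a x z) * w
    - y * ((quartic a).derivative.derivative.eval z / 2 * (x - z)
      + 3 / 2 * (quartic a).derivative.eval z) * w

/-- The second derivative of `kleinWp` along the invariant vector field in `(z, w)`. -/
noncomputable def kleinWpDeriv₂ (a : Fin 5 → ℂ) (x y z w : ℂ) : ℂ :=
  (kleinWpNumDeriv a x y z w * (x - z) + 3 * kleinWpNum a x y z w * w) / (2 * (x - z) ^ 4)

theorem kleinRelation_iff (a : Fin 5 → ℂ) {x y z w p : ℂ} (h : x ≠ z) :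
    KleinRelation a x y z w p ↔ p = kleinWp a x y z w := by
  have hd : x - z ≠ 0 := sub_ne_zero.2 h
  rw [kleinWp, eq_div_iff (mul_ne_zero two_ne_zero (pow_ne_zero 2 hd))]
  simp only [KleinRelation, kleinMatrix, monomialVec, polarForm, Matrix.mulVec, dotProduct,
    Fin.sum_univ_three, Matrix.of_apply, Matrix.cons_val]
  constructor <;> intro h <;> linear_combination h

theorem kleinMatrix_det (a : Fin 5 → ℂ) (p : ℂ) :
    -(1 / 4) * (kleinMatrix a p).det =
      4 * p ^ 3 - (a 0 * a 4 - 4 * a 1 * a 3 + 3 * a 2 ^ 2) * p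
        - a 0 * a 2 * a 4 + a 0 * a 3 ^ 2 - 2 * a 1 * a 2 * a 3 + a 2 ^ 3 + a 1 ^ 2 * a 4 := by
  simp only [kleinMatrix, Matrix.det_fin_three, Matrix.of_apply, Matrix.cons_val]
  ring

theorem kleinWpDeriv_sq (a : Fin 5 → ℂ) {x y z w : ℂ} (h : x ≠ z)
    (hy : y ^ 2 = (quartic a).eval x) (hw : w ^ 2 = (quartic a).eval z) :
    kleinWpDeriv a x y z w ^ 2 - 4 * kleinWp a x y z w ^ 3 =
      -(a 0 * a 4 - 4 * a 1 * a 3 + 3 * a 2 ^ 2) * kleinWp a x y z w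
        - a 0 * a 2 * a 4 + a 0 * a 3 ^ 2 - 2 * a 1 * a 2 * a 3 + a 2 ^ 3 + a 1 ^ 2 * a 4 := by
  have hd : x - z ≠ 0 := sub_ne_zero.2 h
  have key : kleinWpNum a x y z w ^ 2 - 2 * (polarForm a x z - y * w) ^ 3 =
      -(a 0 * a 4 - 4 * a 1 * a 3 + 3 * a 2 ^ 2) * (polarForm a x z - y * w) * 2 * (x - z) ^ 4
        + 4 * (- a 0 * a 2 * a 4 + a 0 * a 3 ^ 2 - 2 * a 1 * a 2 * a 3 + a 2 ^ 3 + a 1 ^ 2 * a 4)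
          * (x - z) ^ 6 := by
    rw [kleinWpNum]
    obtain ⟨P, hP⟩ : ∃ P, P = polarFormDeriv a x z * (x - z) + 2 * polarForm a x z := ⟨_, rfl⟩
    obtain ⟨Q, hQ⟩ : ∃ Q, Q = (quartic a).derivative.eval z / 2 * (x - z)
      + 2 * (quartic a).eval z := ⟨_, rfl⟩
    -- Modulo the curve equations both sides are affine in `y * w`; `h1` compares the constant parts
    -- and `h2` the coefficients of `y * w`, halved.
    have h1 : (quartic a).eval z * P ^ 2 + (quartic a).eval x * Q ^ 2 - 2 * polarForm a x z ^ 3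
        - 6 * polarForm a x z * (quartic a).eval x * (quartic a).eval z =
        -2 * (a 0 * a 4 - 4 * a 1 * a 3 + 3 * a 2 ^ 2) * polarForm a x z * (x - z) ^ 4
        + 4 * (- a 0 * a 2 * a 4 + a 0 * a 3 ^ 2 - 2 * a 1 * a 2 * a 3 + a 2 ^ 3 + a 1 ^ 2 * a 4)
          * (x - z) ^ 6 := by
      simp only [hP, hQ, polarForm, polarFormDeriv, quartic_eval, quartic_derivative_eval]
      ring
    have h2 : -P * Q + 3 * polarForm a x z ^ 2 + (quartic a).eval x * (quartic a).eval z =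
        (a 0 * a 4 - 4 * a 1 * a 3 + 3 * a 2 ^ 2) * (x - z) ^ 4 := by
      simp only [hP, hQ, polarForm, polarFormDeriv, quartic_eval, quartic_derivative_eval]
      ring
    rw [← hP, ← hQ]
    linear_combination h1 + 2 * y * w * h2
      + (P ^ 2 - 2 * (3 * polarForm a x z - y * w) * y ^ 2) * hw
      + (Q ^ 2 - 2 * (3 * polarForm a x z - y * w) * (quartic a).eval z) * hy
  rw [kleinWpDeriv, kleinWp]
  field_simp
  linear_combination 2 * key

theorem kleinWpDeriv₂_eq (a : Fin 5 → ℂ) {x y z w : ℂ} (h : x ≠ z)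
    (hy : y ^ 2 = (quartic a).eval x) (hw : w ^ 2 = (quartic a).eval z) :
    kleinWpDeriv₂ a x y z w = 6 * kleinWp a x y z w ^ 2
      - (1 / 2) * (a 0 * a 4 - 4 * a 1 * a 3 + 3 * a 2 ^ 2) := by
  have hd : x - z ≠ 0 := sub_ne_zero.2 h
  have key : kleinWpNumDeriv a x y z w * (x - z) + 3 * kleinWpNum a x y z w * w =
      3 * (polarForm a x z - y * w) ^ 2
        - (a 0 * a 4 - 4 * a 1 * a 3 + 3 * a 2 ^ 2) * (x - z) ^ 4 := by
    have h1 : (quartic a).derivative.eval z / 2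
          * (polarFormDeriv a x z * (x - z) + 2 * polarForm a x z) * (x - z)
        + (quartic a).eval z * ((polarFormDeriv₂ a x * (x - z) + polarFormDeriv a x z) * (x - z)
          + 3 * (polarFormDeriv a x z * (x - z) + 2 * polarForm a x z)) =
        3 * polarForm a x z ^ 2 + 3 * (quartic a).eval x * (quartic a).eval z
          - (a 0 * a 4 - 4 * a 1 * a 3 + 3 * a 2 ^ 2) * (x - z) ^ 4 := by
      simp only [polarForm, polarFormDeriv, polarFormDeriv₂, quartic_eval,
        quartic_derivative_eval]
      ring
    have h2 : ((quartic a).derivative.derivative.eval z / 2 * (x - z)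
          + 3 / 2 * (quartic a).derivative.eval z) * (x - z)
        + 3 * ((quartic a).derivative.eval z / 2 * (x - z) + 2 * (quartic a).eval z) =
        6 * polarForm a x z := by
      simp only [polarForm, quartic_eval, quartic_derivative_eval,
        quartic_derivative_derivative_eval]
      ring
    rw [kleinWpNum, kleinWpNumDeriv]
    linear_combination h1 - y * w * h2
      + ((polarFormDeriv₂ a x * (x - z) + polarFormDeriv a x z) * (x - z)
        + 3 * (polarFormDeriv a x z * (x - z) + 2 * polarForm a x z) - 3 * y ^ 2) * hw
      - 3 * (quartic a).eval z * hy
  rw [kleinWpDeriv₂, kleinWp]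
  field_simp
  linear_combination 2 * key

/-! ### Derivatives along the invariant vector field -/

section Deriv

variable {a : Fin 5 → ℂ} {X Y v : ℂ} {x y : ℂ → ℂ}

/-- The quotient rule produces `w²`; the curve equation replaces it by the quartic, which makes the
numerator linear in `y` and `w`. -/
theorem hasDerivAt_kleinWp (h : X ≠ x v) (hc : y v ^ 2 = (quartic a).eval (x v))
    (hx : HasDerivAt x (y v) v)
    (hy : HasDerivAt y ((quartic a).derivative.eval (x v) / 2) v) :
    HasDerivAt (fun t ↦ kleinWp a X Y (x t) (y t)) (kleinWpDeriv a X Y (x v) (y v)) v := by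
  have hd : X - x v ≠ 0 := sub_ne_zero.2 h
  have h1 := (((hasDerivAt_polarForm a X (x v)).comp v hx).sub (hy.const_mul Y)).div
    (((hx.const_sub X).pow 2).const_mul 2) (by simpa using hd)
  refine h1.congr_deriv ?_
  simp only [kleinWpDeriv, kleinWpNum, Function.comp_apply, Pi.sub_apply, Pi.pow_apply, ← hc]
  field_simp
  ring

theorem hasDerivAt_kleinWpDeriv (h : X ≠ x v)
    (hx : HasDerivAt x (y v) v)
    (hy : HasDerivAt y ((quartic a).derivative.eval (x v) / 2) v) :
    HasDerivAt (fun t ↦ kleinWpDeriv a X Y (x t) (y t)) (kleinWpDeriv₂ a X Y (x v) (y v)) v := by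
  have hd : X - x v ≠ 0 := sub_ne_zero.2 h
  have hX := hx.const_sub X
  have hH := (hasDerivAt_polarForm a X (x v)).comp v hx
  have hH' := (hasDerivAt_polarFormDeriv a X (x v)).comp v hx
  have hA := ((quartic a).hasDerivAt (x v)).comp v hx
  have hA' := ((quartic a).derivative.hasDerivAt (x v)).comp v hx
  have hN := (hy.mul ((hH'.mul hX).add (hH.const_mul 2))).sub
    ((((hA'.div_const 2).mul hX).add (hA.const_mul 2)).const_mul Y)
  have h1 := hN.div ((hX.pow 3).const_mul 2) (by simpa using hd)
  refine h1.congr_deriv ?_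
  simp only [kleinWpDeriv₂, kleinWpNum, kleinWpNumDeriv, Function.comp_apply, Pi.sub_apply,
    Pi.pow_apply, Pi.add_apply, Pi.mul_apply]
  field_simp
  ring

end Deriv

/-! ### Invariance under opposite motions -/

theorem HasDerivAt.polarForm (a : Fin 5 → ℂ) {x z : ℂ → ℂ} {x' z' t : ℂ}
    (hx : HasDerivAt x x' t) (hz : HasDerivAt z z' t) :
    HasDerivAt (fun s ↦ polarForm a (x s) (z s))
      (polarFormDeriv a (z t) (x t) * x' + polarFormDeriv a (x t) (z t) * z') t := by
  have hs := hx.add hz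
  have hp := hx.mul hz
  have h := ((hs.const_mul (2 * a 1)).const_add (a 0)).add
    ((((hx.pow 2).add (hp.const_mul 4)).add (hz.pow 2)).const_mul (a 2)) |>.add
    ((hp.const_mul (2 * a 3)).mul hs) |>.add ((hp.pow 2).const_mul (a 4))
  refine (h.congr_deriv ?_).congr_of_eventuallyEq (.of_forall fun s ↦ ?_)
  · simp only [polarFormDeriv, Pi.add_apply, Pi.mul_apply]; ring
  · simp only [_root_.polarForm, Pi.add_apply, Pi.mul_apply, Pi.pow_apply]; ring

/-- `kleinWp` is invariant under opposite motions of its two arguments. -/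
theorem hasDerivAt_kleinWp_zero {a : Fin 5 → ℂ} {x y z w : ℂ → ℂ} {t : ℂ} (h : x t ≠ z t)
    (hc : y t ^ 2 = (quartic a).eval (x t)) (hc' : w t ^ 2 = (quartic a).eval (z t))
    (hx : HasDerivAt x (y t) t) (hy : HasDerivAt y ((quartic a).derivative.eval (x t) / 2) t)
    (hz : HasDerivAt z (-w t) t)
    (hw : HasDerivAt w (-((quartic a).derivative.eval (z t) / 2)) t) :
    HasDerivAt (fun s ↦ kleinWp a (x s) (y s) (z s) (w s)) 0 t := by
  have hd : x t - z t ≠ 0 := sub_ne_zero.2 h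
  have h1 := ((hx.polarForm a hz).sub (hy.mul hw)).div
    (((hx.sub hz).pow 2).const_mul 2) (by simpa using hd)
  refine h1.congr_deriv ?_
  rw [div_eq_zero_iff]
  left
  -- After reducing `y²` and `w²`, the numerator is linear in `y` and `w`; `e1` and `e2` kill the
  -- two coefficients. They are exchanged, up to sign, by swapping `x` and `z`.
  have e1 : polarFormDeriv a (z t) (x t) * (x t - z t) - 2 * polarForm a (x t) (z t)
      + (quartic a).derivative.eval (z t) / 2 * (x t - z t) + 2 * (quartic a).eval (z t) = 0 := by
    simp only [polarForm, polarFormDeriv, quartic_eval, quartic_derivative_eval]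
    ring
  have e2 : polarFormDeriv a (x t) (z t) * (x t - z t) + 2 * polarForm a (x t) (z t)
      + (quartic a).derivative.eval (x t) / 2 * (x t - z t) - 2 * (quartic a).eval (x t) = 0 := by
    simp only [polarForm, polarFormDeriv, quartic_eval, quartic_derivative_eval]
    ring
  simp only [Pi.sub_apply, Pi.pow_apply, Pi.mul_apply]
  linear_combination 2 * (x t - z t) * (y t * e1 - w t * e2 + 2 * y t * hc' + 2 * w t * hc)

/-! ### Abelian parametrizations -/

namespace IsAbelianParam

variable {a : Fin 5 → ℂ} {D : Set ℂ} {x y : ℂ → ℂ}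

theorem eventually_analyticAt (h : IsAbelianParam a D x y) {u : ℂ} (hu : u ∈ D) :
    ∀ᶠ t in 𝓝[≠] u, t ∈ D ∧ AnalyticAt ℂ x t ∧ AnalyticAt ℂ y t :=
  (eventually_nhdsWithin_of_eventually_nhds (h.isOpen.eventually_mem hu)).and
    ((h.meromorphic_x u hu).eventually_analyticAt.and
      (h.meromorphic_y u hu).eventually_analyticAt)

/-- The abscissa of an abelian parametrization is nowhere locally constant. -/
theorem eventually_ne (h : IsAbelianParam a D x y) (ha : IsGenusOne a) {u : ℂ} (hu : u ∈ D)
    (c : ℂ) : ∀ᶠ t in 𝓝[≠] u, c ≠ x t := by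
  rcases ((h.meromorphic_x u hu).sub (.const c u)).eventually_eq_zero_or_eventually_ne_zero
    with h0 | h0
  · exfalso
    -- If `x` is locally constant, then `y = x' = 0`, hence `y' = 0`: the quartic and its derivative
    -- vanish together, against the Bézout identity from separability.
    have key : ∀ᶠ t in 𝓝[≠] u, x t = c ∧ y t = 0 := by
      filter_upwards [eventually_eventually_nhdsWithin.2 h0,
        eventually_nhdsWithin_of_forall (s := {u}ᶜ) fun _ ht ↦ ht, h0,
        h.eventually_analyticAt hu] with t ht htu ht0 ⟨htD, htx, hty⟩
      rw [nhdsWithin_eq_nhds.2 (isOpen_compl_singleton.mem_nhds htu)] at ht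
      refine ⟨sub_eq_zero.1 ht0, (h.deriv_x t htD htx hty).unique ?_⟩
      exact (hasDerivAt_const t c).congr_of_eventuallyEq (ht.mono fun s hs ↦ sub_eq_zero.1 hs)
    obtain ⟨t, ht, htu, ⟨hxt, hyt⟩, htD, htx, hty⟩ :=
      ((eventually_eventually_nhdsWithin.2 key).and
        ((eventually_nhdsWithin_of_forall (s := {u}ᶜ) fun _ ht ↦ ht).and
          (key.and (h.eventually_analyticAt hu)))).exists
    rw [nhdsWithin_eq_nhds.2 (isOpen_compl_singleton.mem_nhds htu)] at ht
    have h1 := (h.deriv_y t htD htx hty).unique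
      ((hasDerivAt_const t 0).congr_of_eventuallyEq (ht.mono fun s hs ↦ hs.2))
    have h2 := h.curve t htD htx hty
    obtain ⟨r, s, hrs⟩ := ha.2
    have h3 := congrArg (Polynomial.eval (x t)) hrs
    simp only [Polynomial.eval_add, Polynomial.eval_mul, Polynomial.eval_one] at h3
    rw [← h2, hyt, (div_eq_zero_iff.1 h1).resolve_right two_ne_zero] at h3
    simp at h3
  · exact h0.mono fun t ht hc ↦ ht (by simp [hc])

theorem hasDerivAt_kleinWp (h : IsAbelianParam a D x y) {X Y u : ℂ} (hu : u ∈ D)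
    (hx : AnalyticAt ℂ x u) (hy : AnalyticAt ℂ y u) (hX : X ≠ x u) :
    HasDerivAt (fun t ↦ kleinWp a X Y (x t) (y t)) (kleinWpDeriv a X Y (x u) (y u)) u :=
  _root_.hasDerivAt_kleinWp hX (h.curve u hu hx hy) (h.deriv_x u hu hx hy) (h.deriv_y u hu hx hy)

end IsAbelianParam

/-! ### Existence, meromorphy and differential equations -/

section KleinWp

variable {a : Fin 5 → ℂ} {D E : Set ℂ} {x y x₁ y₁ : ℂ → ℂ}

theorem MeromorphicAt.kleinWp (a : Fin 5 → ℂ) {x y z w : ℂ → ℂ} {t : ℂ}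
    (hx : MeromorphicAt x t) (hy : MeromorphicAt y t) (hz : MeromorphicAt z t)
    (hw : MeromorphicAt w t) :
    MeromorphicAt (fun s ↦ kleinWp a (x s) (y s) (z s) (w s)) t := by
  unfold _root_.kleinWp polarForm
  fun_prop

theorem MeromorphicAt.comp_const_sub {f : ℂ → ℂ} {w t : ℂ} (h : MeromorphicAt f (w - t)) :
    MeromorphicAt (fun s ↦ f (w - s)) t :=
  h.comp_analyticAt (g := fun s ↦ w - s) (by fun_prop)

theorem MeromorphicAt.comp_sub_const {f : ℂ → ℂ} {u t : ℂ} (h : MeromorphicAt f (t - u)) :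
    MeromorphicAt (fun s ↦ f (s - u)) t :=
  h.comp_analyticAt (g := fun s ↦ s - u) (by fun_prop)

/-- The value of `kleinWp` at two points of the curve depends only on the sum of their
parameters. -/
theorem kleinWp_eq_of_add_eq (hD : IsAbelianParam a D x y) (hE : IsAbelianParam a E x₁ y₁)
    {u v u' v' : ℂ} (h : u + v = u' + v') (hu : u ∈ D) (hv : v ∈ E) (hu' : u' ∈ D) (hv' : v' ∈ E)
    (hx : AnalyticAt ℂ x u) (hy : AnalyticAt ℂ y u)
    (hx₁ : AnalyticAt ℂ x₁ v) (hy₁ : AnalyticAt ℂ y₁ v) (hne : x u ≠ x₁ v)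
    (hx' : AnalyticAt ℂ x u') (hy' : AnalyticAt ℂ y u')
    (hx₁' : AnalyticAt ℂ x₁ v') (hy₁' : AnalyticAt ℂ y₁ v') (hne' : x u' ≠ x₁ v') :
    kleinWp a (x u) (y u) (x₁ v) (y₁ v) = kleinWp a (x u') (y u') (x₁ v') (y₁ v') := by
  obtain ⟨w, hw⟩ : ∃ w, w = u + v := ⟨_, rfl⟩
  obtain rfl : v = w - u := by rw [hw]; ring
  obtain rfl : v' = w - u' := by rw [hw, h]; ring
  have hτ (t : ℂ) : AnalyticAt ℂ (fun s ↦ w - s) t := by fun_prop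
  let G (s : ℂ) : ℂ := kleinWp a (x s) (y s) (x₁ (w - s)) (y₁ (w - s))
  let c : ℂ := G u
  have hG (t : ℂ) (h1 : AnalyticAt ℂ x t) (h2 : AnalyticAt ℂ y t) (h3 : AnalyticAt ℂ x₁ (w - t))
      (h4 : AnalyticAt ℂ y₁ (w - t)) (h5 : x t ≠ x₁ (w - t)) : AnalyticAt ℂ G t := by
    have h3' := h3.fun_comp (hτ t)
    have h4' := h4.fun_comp (hτ t)
    have h6 : 2 * (x t - x₁ (w - t)) ^ 2 ≠ 0 :=
      mul_ne_zero two_ne_zero (pow_ne_zero 2 (sub_ne_zero.2 h5))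
    simp only [G, kleinWp, polarForm]
    fun_prop (disch := assumption)
  have hGu := hG u hx hy hx₁ hy₁ hne
  have hGu' := hG u' hx' hy' hx₁' hy₁' hne'
  let S : Set ℂ := D ∩ (fun s ↦ w - s) ⁻¹' E
  -- Convexity of `D` and `E` enters here: `D ∩ (w - E)` is convex, hence connected.
  have hS : IsPreconnected S := by
    refine (hD.convex.inter ?_).isPreconnected
    have := hE.convex.affine_preimage ((AffineMap.const ℝ ℂ w) - (AffineMap.id ℝ ℂ))
    exact this
  have hmero : MeromorphicOn (fun s ↦ G s - c) S := fun t ht ↦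
    (MeromorphicAt.kleinWp a (hD.meromorphic_x t ht.1) (hD.meromorphic_y t ht.1)
      (hE.meromorphic_x _ ht.2).comp_const_sub (hE.meromorphic_y _ ht.2).comp_const_sub).sub
      (.const c t)
  have hnear : ∀ᶠ t in 𝓝 u, HasDerivAt G 0 t := by
    have hcont : Tendsto (fun s ↦ w - s) (𝓝 u) (𝓝 (w - u)) := (hτ u).continuousAt
    have hdiff : ∀ᶠ t in 𝓝 u, x t - x₁ (w - t) ≠ 0 :=
      (hx.continuousAt.sub (hx₁.fun_comp (hτ u)).continuousAt).eventually_ne (sub_ne_zero.2 hne)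
    filter_upwards [hx.eventually_analyticAt, hy.eventually_analyticAt,
      hcont.eventually hx₁.eventually_analyticAt, hcont.eventually hy₁.eventually_analyticAt,
      hD.isOpen.eventually_mem hu, hcont.eventually (hE.isOpen.eventually_mem hv), hdiff]
      with t h1 h2 h3 h4 h5 h6 h7
    have hsub : HasDerivAt (fun s ↦ w - s) (-1) t := (hasDerivAt_id' t).const_sub w
    refine hasDerivAt_kleinWp_zero (z := fun s ↦ x₁ (w - s)) (w := fun s ↦ y₁ (w - s))
      (sub_ne_zero.1 h7) (hD.curve t h5 h1 h2) (hE.curve _ h6 h3 h4) (hD.deriv_x t h5 h1 h2)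
      (hD.deriv_y t h5 h1 h2) ?_ ?_
    · exact ((hE.deriv_x _ h6 h3 h4).comp t hsub).congr_deriv (by ring)
    · exact ((hE.deriv_y _ h6 h3 h4).comp t hsub).congr_deriv (by ring)
  have hconst : ∀ᶠ t in 𝓝 u, G t - c = 0 := by
    obtain ⟨r, hr, hball⟩ := Metric.eventually_nhds_iff_ball.1 hnear
    refine Metric.eventually_nhds_iff_ball.2 ⟨r, hr, fun t ht ↦ sub_eq_zero.2 ?_⟩
    exact (convex_ball u r).is_const_of_fderivWithin_eq_zero (𝕜 := ℂ)
      (fun s hs ↦ (hball s hs).differentiableAt.differentiableWithinAt)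
      (fun s hs ↦ by
        rw [fderivWithin_of_isOpen Metric.isOpen_ball hs]
        ext; simp [(hball s hs).deriv]) ht (Metric.mem_ball_self hr)
  -- Identity theorem: infinite order at `u` propagates through `S` to `u'`, even past poles and
  -- points where the abscissae agree.
  have htop : meromorphicOrderAt (fun s ↦ G s - c) u' = ⊤ := by
    by_contra hcon
    exact hmero.meromorphicOrderAt_ne_top_of_isPreconnected hS ⟨hu', hv'⟩ ⟨hu, hv⟩ hcon
      (meromorphicOrderAt_eq_top_iff.2 (eventually_nhdsWithin_of_eventually_nhds hconst))
  have hlim := (hGu'.continuousAt.sub continuousAt_const).eventuallyEq_nhds_iff_eventuallyEq_nhdsNE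
    (continuousAt_const (y := (0 : ℂ))) |>.1 (meromorphicOrderAt_eq_top_iff.1 htop)
  exact (sub_eq_zero.1 hlim.eq_of_nhds).symm

theorem exists_isKleinWp (hD : IsAbelianParam a D x y) (hE : IsAbelianParam a E x₁ y₁) :
    ∃ p : ℂ → ℂ, IsKleinWp a D x y E x₁ y₁ p := by
  have key (w : ℂ) : ∃ q, ∀ u ∈ D, ∀ v ∈ E, u + v = w → AnalyticAt ℂ x u → AnalyticAt ℂ y u →
      AnalyticAt ℂ x₁ v → AnalyticAt ℂ y₁ v → x u ≠ x₁ v →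
      q = kleinWp a (x u) (y u) (x₁ v) (y₁ v) := by
    by_cases hw : ∃ u ∈ D, ∃ v ∈ E, u + v = w ∧ AnalyticAt ℂ x u ∧ AnalyticAt ℂ y u ∧
      AnalyticAt ℂ x₁ v ∧ AnalyticAt ℂ y₁ v ∧ x u ≠ x₁ v
    · obtain ⟨u, hu, v, hv, h, h1, h2, h3, h4, h5⟩ := hw
      exact ⟨kleinWp a (x u) (y u) (x₁ v) (y₁ v), fun u' hu' v' hv' h' h1' h2' h3' h4' h5' ↦
        kleinWp_eq_of_add_eq hD hE (h.trans h'.symm) hu hv hu' hv' h1 h2 h3 h4 h5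
          h1' h2' h3' h4' h5'⟩
    -- No admissible pair has sum `w`, so any value would do.
    · exact ⟨0, fun u hu v hv h h1 h2 h3 h4 h5 ↦
        (hw ⟨u, hu, v, hv, h, h1, h2, h3, h4, h5⟩).elim⟩
  choose p hp using key
  exact ⟨p, fun u hu v hv h1 h2 h3 h4 h5 ↦
    (kleinRelation_iff a h5).2 (hp _ u hu v hv rfl h1 h2 h3 h4 h5)⟩

variable {p : ℂ → ℂ}

/-- Around each point of `D + E`, a `℘`-function is given by `kleinWp` with one of the two points
of the curve fixed. -/
theorem IsKleinWp.exists_eventually (ha : IsGenusOne a) (hD : IsAbelianParam a D x y)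
    (hE : IsAbelianParam a E x₁ y₁) (hp : IsKleinWp a D x y E x₁ y₁ p) {w : ℂ} (hw : w ∈ D + E) :
    ∃ u ∈ D, w - u ∈ E ∧ y u ^ 2 = (quartic a).eval (x u) ∧ ∀ᶠ t in 𝓝[≠] w,
      (t - u ∈ E ∧ AnalyticAt ℂ x₁ (t - u) ∧ AnalyticAt ℂ y₁ (t - u) ∧ x u ≠ x₁ (t - u)) ∧
      p t = kleinWp a (x u) (y u) (x₁ (t - u)) (y₁ (t - u)) := by
  obtain ⟨u₀, hu₀, v₀, hv₀, rfl⟩ := Set.mem_add.1 hw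
  have hcont : Tendsto (fun s ↦ u₀ + v₀ - s) (𝓝 u₀) (𝓝 v₀) :=
    (Continuous.tendsto' (by fun_prop) _ _ (by ring))
  -- The given `u₀` may be a pole, so the frozen point is a nearby regular `u`, close enough that `w
  -- - u` stays in `E`.
  obtain ⟨u, ⟨hu, hxu, hyu⟩, hv⟩ := ((hD.eventually_analyticAt hu₀).and
    (eventually_nhdsWithin_of_eventually_nhds
      (hcont.eventually (hE.isOpen.eventually_mem hv₀)))).exists
  refine ⟨u, hu, hv, hD.curve u hu hxu hyu, ?_⟩
  have hshift : Tendsto (fun t ↦ t - u) (𝓝[≠] (u₀ + v₀)) (𝓝[≠] (u₀ + v₀ - u)) :=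
    tendsto_nhdsWithin_of_tendsto_nhds_of_eventually_within _
      ((Continuous.tendsto (by fun_prop) _).mono_left nhdsWithin_le_nhds)
      (eventually_nhdsWithin_of_forall fun t ht h ↦ ht (sub_left_injective h))
  filter_upwards [hshift.eventually (hE.eventually_analyticAt hv),
    hshift.eventually (hE.eventually_ne ha hv (x u))] with t ⟨h1, h2, h3⟩ h4
  refine ⟨⟨h1, h2, h3, h4⟩, ?_⟩
  have := (kleinRelation_iff a h4).1 (hp u hu (t - u) h1 hxu hyu h2 h3 h4)
  rwa [add_sub_cancel] at this

theorem IsKleinWp.meromorphicOn (ha : IsGenusOne a) (hD : IsAbelianParam a D x y)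
    (hE : IsAbelianParam a E x₁ y₁) (hp : IsKleinWp a D x y E x₁ y₁ p) :
    MeromorphicOn p (D + E) := by
  intro w hw
  obtain ⟨u, hu, hv, -, h⟩ := hp.exists_eventually ha hD hE hw
  exact (MeromorphicAt.kleinWp a (.const (x u) w) (.const (y u) w)
    (hE.meromorphic_x _ hv).comp_sub_const (hE.meromorphic_y _ hv).comp_sub_const).congr
    (h.mono fun t ht ↦ ht.2.symm)

/-- The differential equations of a `℘`-function hold in a punctured neighbourhood of each point
of `D + E`. -/
theorem IsKleinWp.eventually_deriv (ha : IsGenusOne a) (hD : IsAbelianParam a D x y)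
    (hE : IsAbelianParam a E x₁ y₁) (hp : IsKleinWp a D x y E x₁ y₁ p) {w : ℂ} (hw : w ∈ D + E) :
    ∀ᶠ t in 𝓝[≠] w,
      deriv p t ^ 2 - 4 * p t ^ 3 =
        -(a 0 * a 4 - 4 * a 1 * a 3 + 3 * a 2 ^ 2) * p t
          - a 0 * a 2 * a 4 + a 0 * a 3 ^ 2 - 2 * a 1 * a 2 * a 3 + a 2 ^ 3 + a 1 ^ 2 * a 4 ∧
      deriv (deriv p) t =
        6 * p t ^ 2 - (1 / 2) * (a 0 * a 4 - 4 * a 1 * a 3 + 3 * a 2 ^ 2) := by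
  obtain ⟨u, hu, -, hc, h⟩ := hp.exists_eventually ha hD hE hw
  -- Differentiating at `t` needs the formula on a full neighbourhood of `t`, which exists because
  -- `t ≠ w`.
  have h' : ∀ᶠ t in 𝓝[≠] w, ∀ᶠ s in 𝓝 t,
      (s - u ∈ E ∧ AnalyticAt ℂ x₁ (s - u) ∧ AnalyticAt ℂ y₁ (s - u) ∧ x u ≠ x₁ (s - u)) ∧
      p s = kleinWp a (x u) (y u) (x₁ (s - u)) (y₁ (s - u)) := by
    filter_upwards [eventually_eventually_nhdsWithin.2 h,
      eventually_nhdsWithin_of_forall (s := {w}ᶜ) fun _ ht ↦ ht] with t ht htw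
    rwa [nhdsWithin_eq_nhds.2 (isOpen_compl_singleton.mem_nhds htw)] at ht
  have h1 : ∀ᶠ t in 𝓝[≠] w, ∀ᶠ s in 𝓝 t,
      deriv p s = kleinWpDeriv a (x u) (y u) (x₁ (s - u)) (y₁ (s - u)) := by
    filter_upwards [h'] with t ht
    filter_upwards [eventually_eventually_nhds.2 ht] with s hs
    obtain ⟨⟨m1, m2, m3, m4⟩, -⟩ := hs.self_of_nhds
    rw [Filter.EventuallyEq.deriv_eq (hs.mono fun _ h ↦ h.2)]
    exact ((hE.hasDerivAt_kleinWp m1 m2 m3 m4).comp_sub_const s u).deriv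
  filter_upwards [h', h1] with t ht ht1
  obtain ⟨⟨m1, m2, m3, m4⟩, hpt⟩ := ht.self_of_nhds
  have hc₁ := hE.curve _ m1 m2 m3
  constructor
  · rw [ht1.self_of_nhds, hpt]
    exact kleinWpDeriv_sq a m4 hc hc₁
  · rw [Filter.EventuallyEq.deriv_eq ht1, hpt, ← kleinWpDeriv₂_eq a m4 hc hc₁]
    exact ((hasDerivAt_kleinWpDeriv m4 (hE.deriv_x _ m1 m2 m3)
      (hE.deriv_y _ m1 m2 m3)).comp_sub_const t u).deriv

end KleinWp

theorem mainTheorem7 (a : Fin 5 → ℂ) (ha : IsGenusOne a)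
    (D E : Set ℂ) (x y x₁ y₁ : ℂ → ℂ)
    (hD : IsAbelianParam a D x y) (hE : IsAbelianParam a E x₁ y₁) :
    (∃ p : ℂ → ℂ, IsKleinWp a D x y E x₁ y₁ p) ∧
    ∀ p : ℂ → ℂ, IsKleinWp a D x y E x₁ y₁ p →
      MeromorphicOn p (D + E) ∧
      ∀ w ∈ D + E, AnalyticAt ℂ p w →
        deriv p w ^ 2 = -(1 / 4) * (kleinMatrix a (p w)).det ∧
        deriv p w ^ 2 - 4 * p w ^ 3 =
          -(a 0 * a 4 - 4 * a 1 * a 3 + 3 * a 2 ^ 2) * p w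
            - a 0 * a 2 * a 4 + a 0 * a 3 ^ 2 - 2 * a 1 * a 2 * a 3 + a 2 ^ 3 + a 1 ^ 2 * a 4 ∧
        deriv (deriv p) w =
          6 * p w ^ 2 - (1 / 2) * (a 0 * a 4 - 4 * a 1 * a 3 + 3 * a 2 ^ 2) := by
  refine ⟨exists_isKleinWp hD hE, fun p hp ↦ ⟨hp.meromorphicOn ha hD hE, fun w hw hpw ↦ ?_⟩⟩
  have h := hp.eventually_deriv ha hD hE hw
  have hp' := hpw.deriv
  have hp'' := hp'.deriv
  -- Both sides are continuous at `w`, as `p` is analytic there, so equality off `w` gives equality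
  -- at `w`.
  have h1 := ((ContinuousAt.eventuallyEq_nhds_iff_eventuallyEq_nhdsNE
    (by fun_prop) (by fun_prop)).1 (h.mono fun t ht ↦ ht.1)).eq_of_nhds
  have h2 := ((ContinuousAt.eventuallyEq_nhds_iff_eventuallyEq_nhdsNE
    (by fun_prop) (by fun_prop)).1 (h.mono fun t ht ↦ ht.2)).eq_of_nhds
  exact ⟨by rw [kleinMatrix_det]; linear_combination h1, h1, h2⟩
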